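/- Let $\mathfrak{S}_n$ be the set of permutations $\pi=\pi(1)\cdots\pi(n)$ of $\{1,\dots,n\}$, with the convention $\pi(n+1)=n+1$. For a pattern $\tau\in\mathfrak S_3$, a set written with $(\tau)$ is restricted to the permutations having no subsequence $\pi(i_1)\pi(i_2)\pi(i_3)$, $i_1<i_2<i_3$, order-isomorphic to $\tau$. Let $\mathsf{des}\,\pi$ be the number of $i\in\{1,\dots,n\}$ with $\pi(i)>\pi(i+1)$, and \begin{align*} (31\text{-}2)\,\pi&=\#\{(i,j): i+1<j\le n,\ \pi(i+1)<\pi(j)<\pi(i)\},\\ (13\text{-}2)\,\pi&=\#\{(i,j): i+1<j\le n,\ \pi(i)<\pi(j)<\pi(i+1)\},\\ (2\text{-}31)\,\pi&=\#\{(i,j): j<i<n,\ \pi(i+1)<\pi(j)<\pi(i)\}. \end{align*} Let $\mathfrak{D}^*_n\subseteq\mathfrak S_n$ be the set of coderangements, i.e. permutations for which no $i\in\{1,\dots,n\}$ satisfies both $\pi(i)=\max\{\pi(1),\dots,\pi(i)\}$ and $\pi(i)<\pi(i+1)$. Let $\mathfrak A_n\subseteq\mathfrak S_n$ be the set of alternating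 (up-down) permutations $\pi(1)<\pi(2)>\pi(3)<\cdots$ of length $n$. Define $C_n(t,q)$ by the continued fraction $$\sum_{n\ge 0}C_n(t,q)z^n=\cfrac{1}{1-\cfrac{z}{1-\cfrac{tz}{1-\cfrac{qz}{1-\cfrac{tqz}{1-\cfrac{q^2z}{1-\cfrac{tq^2z}{\ddots}}}}}}},$$ and put $C_n(q):=C_n(q,q^2)$ (Carlitz's $q$-Catalan numbers) and $C^*_n(q):=\sum_{\pi\in\mathfrak{A}_{2n}(132)}q^{(2\text{-}31)\,\pi}$. Theorem. For every $n\ge 1$, \begin{align*} \sum_{\pi\in\mathfrak{S}_n(231)}(-1)^{\mathsf{des}\,\pi}q^{(31\text{-}2)\,\pi}=\sum_{\pi\in\mathfrak{S}_n(231)}(-1)^{\mathsf{des}\,\pi}q^{(13\text{-}2)\,\pi}&=\begin{cases}0 & \text{if } n \text{ is even},\\ (-q)^{\frac{n-1}{2}}C_{\frac{n-1}{2}}(q^2) & \text{if } n \text{ is odd},\end{cases}\\ \sum_{\pi\in\mathfrak{D}^*_n(231)}(-q)^{\mathsf{des}\,\pi}q^{(31\text{-}2)\,\pi}&=\begin{cases}(-q)^{\frac{n}{2}}C_{\frac{n}{2}}(q^2)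 & \text{if } n \text{ is even},\\ 0 & \text{if } n \text{ is odd},\end{cases}\\ \sum_{\pi\in\mathfrak{D}^*_n(231)}(-1)^{\mathsf{des}\,\pi}q^{(13\text{-}2)\,\pi}&=\begin{cases}(-1)^{\frac{n}{2}}C^*_{\frac{n}{2}}(q) & \text{if } n \text{ is even},\\ 0 & \text{if } n \text{ is odd}.\end{cases} \end{align*} These are polynomial identities in $q$; equivalently, they hold for every element $q$ of every commutative ring. -/

import Mathlib

/-! Permutations of `[n]` are elements of `Equiv.Perm (Fin n)`: positions and letters are numbered
from `0` to `n - 1` instead of from `1` to `n`. -/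

namespace PermStat

variable {n : ℕ}

/-- `π` contains the pattern `p` (a word, e.g. `![2, 3, 1]`): some subsequence of the one-line
notation of `π` is order-isomorphic to `p`. -/
def Contains {k : ℕ} (π : Equiv.Perm (Fin n)) (p : Fin k → ℕ) : Prop :=
  ∃ f : Fin k → Fin n, (∀ a b, a < b → f a < f b) ∧ ∀ a b, π (f a) < π (f b) ↔ p a < p b

/-- `π` avoids the pattern `p`. -/
def Avoids {k : ℕ} (π : Equiv.Perm (Fin n)) (p : Fin k → ℕ) : Prop := ¬ Contains π p

instance {k : ℕ} (π : Equiv.Perm (Fin n)) (p : Fin k → ℕ) : Decidable (Avoids π p) := by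
  unfold Avoids Contains; infer_instance

/-- The letter following position `i`, with the convention that the letter after the last position
is larger than all letters of `π` (that is, `π(n+1) = n+1` when counting from `1`). -/
def next (π : Equiv.Perm (Fin n)) (i : Fin n) : ℕ :=
  if h : (i : ℕ) + 1 < n then (π ⟨i + 1, h⟩ : ℕ) else n

/-- The number of descents. -/
def des (π : Equiv.Perm (Fin n)) : ℕ :=
  (Finset.univ.filter fun i : Fin n => next π i < (π i : ℕ)).card

/-- The number of foremaxima: letters that are both a left-to-right maximum and an ascent bottom. -/
def fmax (π : Equiv.Perm (Fin n)) : ℕ :=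
  (Finset.univ.filter fun i : Fin n => (∀ j ≤ i, π j ≤ π i) ∧ (π i : ℕ) < next π i).card

/-- The number of occurrences `(i, j)` of the vincular pattern `31-2`. -/
def vinc31_2 (π : Equiv.Perm (Fin n)) : ℕ :=
  (Finset.univ.filter fun x : Fin n × Fin n =>
    (x.1 : ℕ) + 1 < x.2 ∧ next π x.1 < (π x.2 : ℕ) ∧ π x.2 < π x.1).card

/-- The number of occurrences `(i, j)` of the vincular pattern `13-2`. -/
def vinc13_2 (π : Equiv.Perm (Fin n)) : ℕ :=
  (Finset.univ.filter fun x : Fin n × Fin n =>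
    (x.1 : ℕ) + 1 < x.2 ∧ π x.1 < π x.2 ∧ (π x.2 : ℕ) < next π x.1).card

/-- The number of occurrences `(i, j)` of the vincular pattern `2-31`. -/
def vinc2_31 (π : Equiv.Perm (Fin n)) : ℕ :=
  (Finset.univ.filter fun x : Fin n × Fin n =>
    x.2 < x.1 ∧ (x.1 : ℕ) + 1 < n ∧ next π x.1 < (π x.2 : ℕ) ∧ π x.2 < π x.1).card

/-- Alternating (up-down) permutations: ascent first, then descents and ascents in turn. -/
def IsAlternating (π : Equiv.Perm (Fin n)) : Prop :=
  ∀ i : Fin n, (i : ℕ) + 1 < n →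
    if Even (i : ℕ) then (π i : ℕ) < next π i else next π i < (π i : ℕ)

instance (π : Equiv.Perm (Fin n)) : Decidable (IsAlternating π) := by
  unfold IsAlternating; infer_instance

/-- `𝔖_n(p)`: permutations of length `n` avoiding `p`. -/
def permAvoiding (n : ℕ) {k : ℕ} (p : Fin k → ℕ) : Finset (Equiv.Perm (Fin n)) :=
  Finset.univ.filter fun π => Avoids π p

/-- `𝔇*_n(p)`: coderangements (no foremaximum) of length `n` avoiding `p`. -/
def coderAvoiding (n : ℕ) {k : ℕ} (p : Fin k → ℕ) : Finset (Equiv.Perm (Fin n)) :=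
  Finset.univ.filter fun π => fmax π = 0 ∧ Avoids π p

/-- `𝔄_n(p)`: alternating permutations of length `n` avoiding `p`. -/
def altAvoiding (n : ℕ) {k : ℕ} (p : Fin k → ℕ) : Finset (Equiv.Perm (Fin n)) :=
  Finset.univ.filter fun π => IsAlternating π ∧ Avoids π p

/-- `C*_n(q)`, the generating function of `2-31` over `𝔄_{2n}(132)`. -/
def cStar {R : Type*} [CommRing R] (n : ℕ) (q : R) : R :=
  ∑ π ∈ altAvoiding (2 * n) ![1, 3, 2], q ^ vinc2_31 π

end PermStat

namespace ContFrac

open PowerSeries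

variable {R : Type*} [CommRing R]

/-- The finite continued fraction `1 / (1 - c 0 z / (1 - c 1 z / (⋯ / (1 - c (m-1) z))))` as a
formal power series in `z` (the inverted series has constant coefficient `1`). -/
noncomputable def convergent : ℕ → (ℕ → R) → PowerSeries R
  | 0, _ => 1
  | m + 1, c => invOfUnit (1 - C (c 0) * X * convergent m (fun k => c (k + 1))) 1

/-- The infinite continued fraction `1 / (1 - c 0 z / (1 - c 1 z / ⋯))`, the limit of the finite
ones: the coefficient of `z ^ n` is the same in all of them from depth `n` on
(`coeff_convergent`). -/
noncomputable def stieltjes (c : ℕ → R) : PowerSeries R :=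
  PowerSeries.mk fun n => coeff n (convergent n c)

theorem convergent_succ_mul (m : ℕ) (c : ℕ → R) :
    (1 - C (c 0) * X * convergent m (fun k => c (k + 1))) * convergent (m + 1) c = 1 := by
  rw [convergent]
  exact mul_invOfUnit _ _ (by simp)

theorem X_pow_dvd_convergent_sub (n : ℕ) : ∀ (m m' : ℕ) (c : ℕ → R), n ≤ m → n ≤ m' →
    (X : PowerSeries R) ^ (n + 1) ∣ convergent m c - convergent m' c := by
  have key : ∀ (m m' : ℕ) (c : ℕ → R), convergent (m + 1) c - convergent (m' + 1) c =
      X * (convergent m (fun k => c (k + 1)) - convergent m' (fun k => c (k + 1))) *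
        (C (c 0) * convergent (m + 1) c * convergent (m' + 1) c) := by
    intro m m' c
    have h1 := convergent_succ_mul m c
    have h2 := convergent_succ_mul m' c
    linear_combination convergent (m' + 1) c * h1 - convergent (m + 1) c * h2
  have zero : ∀ (m : ℕ) (c : ℕ → R), (X : PowerSeries R) ∣ convergent m c - 1 := by
    intro m c
    cases m with
    | zero => simp [convergent]
    | succ m =>
      have h := convergent_succ_mul m c
      exact ⟨C (c 0) * convergent m (fun k => c (k + 1)) * convergent (m + 1) c, by
        linear_combination h⟩
  induction n with
  | zero =>
    intro m m' c _ _
    have := dvd_sub (zero m c) (zero m' c)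
    simpa using this
  | succ n ih =>
    intro m m' c hm hm'
    obtain ⟨m, rfl⟩ := Nat.exists_eq_add_of_le' (show 1 ≤ m by omega)
    obtain ⟨m', rfl⟩ := Nat.exists_eq_add_of_le' (show 1 ≤ m' by omega)
    rw [key, pow_succ']
    exact Dvd.dvd.mul_right (mul_dvd_mul_left _ (ih m m' _ (by omega) (by omega))) _

theorem coeff_convergent {n m : ℕ} (h : n ≤ m) (c : ℕ → R) :
    coeff n (convergent m c) = coeff n (stieltjes c) := by
  have := X_pow_dvd_iff.mp (X_pow_dvd_convergent_sub n m n c h le_rfl) n (by omega)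
  rw [stieltjes, coeff_mk]
  rwa [map_sub, sub_eq_zero] at this

/-- The `(q,t)`-Catalan number `C_n(t,q)`: the coefficient of `z ^ n` in
`1 / (1 - z / (1 - t z / (1 - q z / (1 - t q z / (1 - q ^ 2 z / (1 - t q ^ 2 z / ⋯))))))`.
It is defined for `t`, `q` in any commutative ring; formal variables are the case of a polynomial
ring. -/
noncomputable def qtCatalan (n : ℕ) (t q : R) : R :=
  coeff n (stieltjes fun k => if Even k then q ^ (k / 2) else t * q ^ (k / 2))

/-- Carlitz's `q`-Catalan number `C_n(q) = C_n(q, q ^ 2)`. -/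
noncomputable def carlitzCatalan (n : ℕ) (q : R) : R := qtCatalan n q (q ^ 2)

end ContFrac

/-! In a 231-avoiding word `a :: w` no letter above `a` precedes one below `a`. So `w` is a word on
the smaller letters followed by a word on the larger ones, and recursively the word is a binary
tree. Each statistic becomes a sum over nodes: descents count left children, and `31-2` and `13-2`
acquire at each node the size of one grandchild subtree. Being a coderangement means that every node
of the right spine has a left child.

Splitting at the root turns the sums into power series in `z` satisfying quadratic functional
equations. Factors `q ^ (size of a subtree)` appear as the substitution `z ↦ q z`. Write `E(z)` for
`evenCarlitz (-1) q`, so that `E(z) = 1 - q z² E(q z) E(z)` by the continued fraction. For the sign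
weights, eliminating the auxiliary series leaves `f(z) (1 + e z f(q z) - e z) = 1 + e z f(q z)`. Its
solution is unique, and for `e = ±1` it is `1 + e z E(z)`. Hence both sums over all 231-avoiders
have series `1 + z E(z)`. For coderangements, `31-2` with `x = -q` gives `E(z)`, and `13-2` with `x
= -1` gives `1 - z² E(z)²`.

Reversal carries `C*` to `13-2` over 231-avoiding words. The same tree calculus gives `1 + z²
E₁(z)²` with `E₁ = evenCarlitz 1 q`, which differs from `1 - z² E(z)²` only by `z² ↦ -z²`. -/

namespace PermStat

/-! ### 231-avoiding words as binary trees -/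

/-- A word avoids `231`: after no letter `a` does a larger letter precede a smaller one. -/
def Avoids231 : List ℕ → Prop
  | [] => True
  | a :: l => l.Pairwise (fun b c => ¬(c < a ∧ a < b)) ∧ Avoids231 l

/-- The word on the letters `s, s + 1, …` whose first letter splits the remaining ones into the
words of the left and right subtrees. -/
def treeWord : ℕ → BinaryTree Unit → List ℕ
  | _, .nil => []
  | s, .node _ l r => (s + l.numNodes) :: (treeWord s l ++ treeWord (s + l.numNodes + 1) r)

theorem length_treeWord (s : ℕ) (t : BinaryTree Unit) : (treeWord s t).length = t.numNodes := by
  induction t generalizing s with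
  | nil => rfl
  | node _ l r hl hr => simp [treeWord, hl, hr, BinaryTree.numNodes]

theorem mem_treeWord {s x : ℕ} {t : BinaryTree Unit} :
    x ∈ treeWord s t ↔ s ≤ x ∧ x < s + t.numNodes := by
  induction t generalizing s with
  | nil => simp [treeWord, BinaryTree.numNodes]
  | node _ l r hl hr =>
    simp only [treeWord, List.mem_cons, List.mem_append, hl, hr, BinaryTree.numNodes]
    omega

theorem treeWord_lt_treeWord {s : ℕ} {l r : BinaryTree Unit} :
    ∀ x ∈ treeWord s l, ∀ y ∈ treeWord (s + l.numNodes + 1) r, x < y := by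
  simp only [mem_treeWord]
  omega

theorem nodup_treeWord (s : ℕ) (t : BinaryTree Unit) : (treeWord s t).Nodup := by
  induction t generalizing s with
  | nil => simp [treeWord]
  | node _ l r hl hr =>
    simp only [treeWord, List.nodup_cons, List.nodup_append, List.mem_append, mem_treeWord]
    refine ⟨by omega, hl _, hr _, by omega⟩

theorem Avoids231.sublist {l m : List ℕ} (h : l.Sublist m) (hm : Avoids231 m) : Avoids231 l := by
  induction h with
  | slnil => exact hm
  | cons a _ ih => exact ih hm.2
  | cons_cons a h ih => exact ⟨hm.1.sublist h, ih hm.2⟩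

theorem Avoids231.append {l m : List ℕ} (h : ∀ x ∈ l, ∀ y ∈ m, x < y) (hl : Avoids231 l)
    (hm : Avoids231 m) : Avoids231 (l ++ m) := by
  induction l with
  | nil => exact hm
  | cons a l ih =>
    simp only [List.mem_cons, forall_eq_or_imp] at h
    refine ⟨List.pairwise_append.2 ⟨hl.1, ?_, ?_⟩, ih h.2 hl.2⟩
    · exact List.pairwise_of_forall_mem_list fun b _ c hc => by have := h.1 c hc; omega
    · intro b _ c hc
      have := h.1 c hc
      omega

theorem avoids231_treeWord (s : ℕ) (t : BinaryTree Unit) : Avoids231 (treeWord s t) := by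
  induction t generalizing s with
  | nil => trivial
  | node _ l r hl hr =>
    refine ⟨List.pairwise_append.2 ⟨?_, ?_, ?_⟩, (hl s).append treeWord_lt_treeWord (hr _)⟩
    · refine List.pairwise_of_forall_mem_list fun b hb c hc => ?_
      rw [mem_treeWord] at hb
      omega
    · refine List.pairwise_of_forall_mem_list fun b hb c hc => ?_
      rw [mem_treeWord] at hc
      omega
    · intro b hb c hc
      rw [mem_treeWord] at hb
      omega

/-- The first letter reveals the size of the left subtree, hence where the rest of the word is to be
cut. -/
theorem treeWord_injective (s : ℕ) : Function.Injective (treeWord s) := by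
  intro t u h
  induction t generalizing s u with
  | nil => cases u <;> simp_all [treeWord]
  | node _ l r hl hr =>
    cases u with
    | nil => simp [treeWord] at h
    | node _ l' r' =>
      simp only [treeWord, List.cons.injEq, add_right_inj] at h
      obtain ⟨h₁, h₂⟩ := h
      rw [← h₁] at h₂
      obtain ⟨h₃, h₄⟩ := List.append_inj h₂ (by simp [length_treeWord, h₁])
      rw [hl _ h₃, hr _ h₄]

/-- Once a letter above `a` has occurred, no letter below `a` can follow. -/
theorem eq_filter_lt_append_filter_gt {a : ℕ} {l : List ℕ} (ha : a ∉ l)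
    (h : l.Pairwise (fun b c => ¬(c < a ∧ a < b))) :
    l = l.filter (· < a) ++ l.filter (a < ·) := by
  induction l with
  | nil => rfl
  | cons b l ih =>
    simp only [List.mem_cons, not_or] at ha
    rw [List.pairwise_cons] at h
    rcases lt_or_gt_of_ne ha.1 with hb | hb
    · have h₁ : l.filter (· < a) = [] := by
        rw [List.filter_eq_nil_iff]
        intro c hc
        have := h.1 c hc
        simp only [decide_eq_true_eq]
        omega
      have := ih ha.2 h.2
      rw [h₁, List.nil_append] at this
      simp [hb, hb.le, h₁, ← this]
    · simp [hb, hb.le, ← ih ha.2 h.2]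

/-- Strong induction: the letters below and above the first one each fill an interval and still
avoid 231, so both come from trees. -/
theorem exists_treeWord_eq {n s : ℕ} {l : List ℕ} (hl : l.Nodup)
    (hmem : ∀ x, x ∈ l ↔ s ≤ x ∧ x < s + n) (h : Avoids231 l) :
    ∃ t, t.numNodes = n ∧ treeWord s t = l := by
  induction n using Nat.strong_induction_on generalizing s l with
  | _ n ih =>
    cases l with
    | nil =>
      have := hmem s
      simp only [List.not_mem_nil, false_iff] at this
      exact ⟨.nil, by simp only [BinaryTree.numNodes]; omega, rfl⟩
    | cons a l =>
      rw [List.nodup_cons] at hl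
      have ha := (hmem a).1 (by simp)
      have hmem' : ∀ x, x ∈ l ↔ x ≠ a ∧ s ≤ x ∧ x < s + n := by
        intro x
        rw [← hmem, List.mem_cons]
        constructor
        · rintro hx
          exact ⟨fun e => hl.1 (e ▸ hx), Or.inr hx⟩
        · tauto
      have hs := eq_filter_lt_append_filter_gt hl.1 h.1
      obtain ⟨t, ht, ht'⟩ := ih (a - s) (by omega) (s := s) (hl.2.filter (· < a))
        (by intro x; simp only [List.mem_filter, hmem', decide_eq_true_eq]; omega)
        (h.2.sublist List.filter_sublist)
      obtain ⟨u, hu, hu'⟩ := ih (s + n - a - 1) (by omega) (s := a + 1) (hl.2.filter (a < ·))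
        (by intro x; simp only [List.mem_filter, hmem', decide_eq_true_eq]; omega)
        (h.2.sublist List.filter_sublist)
      refine ⟨.node () t u, by simp only [BinaryTree.numNodes]; omega, ?_⟩
      have e : s + t.numNodes = a := by omega
      rw [treeWord, e, ht', hu', ← hs]

/-- The one-line notation of a permutation. -/
def word {n : ℕ} (π : Equiv.Perm (Fin n)) : List ℕ := List.ofFn fun i => (π i : ℕ)

theorem word_injective (n : ℕ) : Function.Injective (word (n := n)) := by
  intro π σ h
  ext i
  exact congrFun (List.ofFn_injective h) i

theorem nodup_word {n : ℕ} (π : Equiv.Perm (Fin n)) : (word π).Nodup :=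
  List.nodup_ofFn.2 (Fin.val_injective.comp π.injective)

theorem mem_word {n : ℕ} (π : Equiv.Perm (Fin n)) (x : ℕ) : x ∈ word π ↔ x < n := by
  rw [word, List.mem_ofFn]
  constructor
  · rintro ⟨i, rfl⟩
    exact (π i).2
  · exact fun h => ⟨π.symm ⟨x, h⟩, by simp⟩

theorem exists_word_eq {n : ℕ} {l : List ℕ} (hl : l.Nodup) (hmem : ∀ x, x ∈ l ↔ x < n)
    (hn : l.length = n) : ∃ π : Equiv.Perm (Fin n), word π = l := by
  subst hn
  have hf : Function.Injective fun i : Fin l.length =>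
      (⟨l.get i, (hmem _).1 (l.get_mem i)⟩ : Fin l.length) := by
    intro i j h
    exact (List.nodup_iff_injective_get.1 hl) (by simpa using h)
  refine ⟨Equiv.ofBijective _ (Finite.injective_iff_bijective.1 hf), ?_⟩
  simp [word]

theorem avoids231_ofFn {n : ℕ} (f : Fin n → ℕ) :
    Avoids231 (List.ofFn f) ↔ ∀ i j k, i < j → j < k → ¬(f k < f i ∧ f i < f j) := by
  induction n with
  | zero => simp [Avoids231]
  | succ n ih =>
    rw [List.ofFn_succ, Avoids231, ih, List.pairwise_ofFn]
    constructor
    · rintro ⟨h₀, h⟩ i j k hij hjk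
      obtain ⟨j, rfl⟩ := Fin.exists_succ_eq.2 (Fin.ne_zero_of_lt hij)
      obtain ⟨k, rfl⟩ := Fin.exists_succ_eq.2 (Fin.ne_zero_of_lt hjk)
      cases i using Fin.cases with
      | zero => exact h₀ (Fin.succ_lt_succ_iff.1 hjk)
      | succ i => exact h i j k (Fin.succ_lt_succ_iff.1 hij) (Fin.succ_lt_succ_iff.1 hjk)
    · intro h
      exact ⟨fun j k hjk => h 0 j.succ k.succ (Fin.succ_pos j) (Fin.succ_lt_succ_iff.2 hjk),
        fun i j k hij hjk => h i.succ j.succ k.succ (Fin.succ_lt_succ_iff.2 hij)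
          (Fin.succ_lt_succ_iff.2 hjk)⟩

theorem avoids_231_iff {n : ℕ} (π : Equiv.Perm (Fin n)) :
    Avoids π ![2, 3, 1] ↔ ∀ i j k, i < j → j < k → ¬(π k < π i ∧ π i < π j) := by
  rw [Avoids, Contains]
  constructor
  · intro h i j k hij hjk hπ
    refine h ⟨![i, j, k], ?_, ?_⟩
    · intro a b hab
      fin_cases a <;> fin_cases b <;> simp_all [hij.trans hjk]
    · have := hπ.1.trans hπ.2
      intro a b
      fin_cases a <;> fin_cases b <;> simp [hπ.1, hπ.2, hπ.1.le, hπ.2.le, this, this.le]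
  · rintro h ⟨f, hf, hf'⟩
    exact h (f 0) (f 1) (f 2) (hf _ _ (by simp)) (hf _ _ (by simp [Fin.lt_def]))
      ⟨(hf' _ _).2 (by simp), (hf' _ _).2 (by simp)⟩

theorem avoids_132_iff {n : ℕ} (π : Equiv.Perm (Fin n)) :
    Avoids π ![1, 3, 2] ↔ ∀ i j k, i < j → j < k → ¬(π i < π k ∧ π k < π j) := by
  rw [Avoids, Contains]
  constructor
  · intro h i j k hij hjk hπ
    refine h ⟨![i, j, k], ?_, ?_⟩
    · intro a b hab
      fin_cases a <;> fin_cases b <;> simp_all [hij.trans hjk]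
    · have := hπ.1.trans hπ.2
      intro a b
      fin_cases a <;> fin_cases b <;> simp [hπ.1, hπ.2, hπ.1.le, hπ.2.le, this, this.le]
  · rintro h ⟨f, hf, hf'⟩
    exact h (f 0) (f 1) (f 2) (hf _ _ (by simp)) (hf _ _ (by simp [Fin.lt_def]))
      ⟨(hf' _ _).2 (by simp), (hf' _ _).2 (by simp)⟩

theorem avoids_231_iff_word {n : ℕ} (π : Equiv.Perm (Fin n)) :
    Avoids π ![2, 3, 1] ↔ Avoids231 (word π) := by
  simp only [avoids_231_iff, word, avoids231_ofFn, Fin.lt_def]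

/-- Sums over `231`-avoiding permutations are sums over binary trees. -/
theorem sum_permAvoiding_231 {M : Type*} [AddCommMonoid M] (n : ℕ) (g : List ℕ → M) :
    ∑ π ∈ permAvoiding n ![2, 3, 1], g (word π) =
      ∑ t ∈ BinaryTree.treesOfNumNodesEq n, g (treeWord 0 t) := by
  -- Both sums are moved to words, where the two index sets coincide; no explicit bijection between
  -- permutations and trees is needed.
  rw [← Finset.sum_image (f := g) (word_injective n).injOn,
    ← Finset.sum_image (f := g) (treeWord_injective 0).injOn]
  congr 1
  ext l
  simp only [Finset.mem_image, permAvoiding, Finset.mem_filter, Finset.mem_univ, true_and,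
    BinaryTree.mem_treesOfNumNodesEq, avoids_231_iff_word]
  constructor
  · rintro ⟨π, hπ, rfl⟩
    exact exists_treeWord_eq (nodup_word π) (by simp [mem_word]) hπ
  · rintro ⟨t, ht, rfl⟩
    obtain ⟨π, hπ⟩ := exists_word_eq (n := n) (nodup_treeWord 0 t) (by simp [mem_treeWord, ht])
      (by rw [length_treeWord, ht])
    exact ⟨π, hπ ▸ avoids231_treeWord 0 t, hπ⟩

end PermStat

/-! ### Statistics on words and their behaviour under concatenation -/

namespace PermStat

/-- The letter `a` is larger than the first letter of the word `l` following it. -/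
def DescHead (a : ℕ) : List ℕ → Prop
  | [] => False
  | b :: _ => b < a

instance (a : ℕ) : DecidablePred (DescHead a)
  | [] => inferInstanceAs (Decidable False)
  | b :: _ => inferInstanceAs (Decidable (b < a))

/-- The number of letters after the first one that are larger than it. -/
def highTail : List ℕ → ℕ
  | [] => 0
  | b :: l => l.countP (b < ·)

/-- The number of letters after the first one that are smaller than it. -/
def lowTail : List ℕ → ℕ
  | [] => 0
  | b :: l => l.countP (· < b)

/-- The number of descents of a word. -/
def wordDes : List ℕ → ℕ
  | [] => 0
  | a :: l => (if DescHead a l then 1 else 0) + wordDes l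

/-- The number of letters `c` of `l` with `l(1) < c < a`. -/
def headBelow (a : ℕ) : List ℕ → ℕ
  | [] => 0
  | b :: l => l.countP fun c => b < c ∧ c < a

/-- The number of letters `c` of `l` with `a < c < l(1)`. -/
def headAbove (a : ℕ) : List ℕ → ℕ
  | [] => 0
  | b :: l => l.countP fun c => a < c ∧ c < b

/-- The number of occurrences of `31-2` in a word. -/
def word31_2 : List ℕ → ℕ
  | [] => 0
  | a :: l => headBelow a l + word31_2 l

/-- The number of occurrences of `13-2` in a word. -/
def word13_2 : List ℕ → ℕ
  | [] => 0
  | a :: l => headAbove a l + word13_2 l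

/-- Every left-to-right maximum of the word that is at least `m` is followed by a descent. -/
def WordCoder : ℕ → List ℕ → Prop
  | _, [] => True
  | m, a :: l => (m ≤ a → DescHead a l) ∧ WordCoder (max m a) l

/-- Ascents and descents alternate in the word, the first step being an ascent if the flag is set;
the last letter is a valley. -/
def WordAlt : Bool → List ℕ → Prop
  | up, [] => up = false
  | true, a :: l => ¬ DescHead a l ∧ WordAlt false l
  | false, a :: l => DescHead a l ∧ WordAlt true l

theorem wordDes_append {l m : List ℕ} (h : ∀ x ∈ l, ∀ y ∈ m, x < y) :
    wordDes (l ++ m) = wordDes l + wordDes m := by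
  induction l with
  | nil => simp [wordDes]
  | cons a l ih =>
    simp only [List.mem_cons, forall_eq_or_imp] at h
    have hd : DescHead a (l ++ m) ↔ DescHead a l := by
      cases l with
      | cons b l => rfl
      | nil =>
        cases m with
        | nil => rfl
        | cons b m =>
          have := h.1 b (by simp)
          simp only [List.nil_append, DescHead, iff_false]
          omega
    simp only [List.cons_append, wordDes, ih h.2, hd]
    ring

/-- The junction is an ascent, and letters of `m` are too large to play the 2 for a descent inside
`l`. -/
theorem word31_2_append {l m : List ℕ} (h : ∀ x ∈ l, ∀ y ∈ m, x < y) :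
    word31_2 (l ++ m) = word31_2 l + word31_2 m := by
  induction l with
  | nil => simp [word31_2]
  | cons a l ih =>
    simp only [List.mem_cons, forall_eq_or_imp] at h
    have hd : headBelow a (l ++ m) = headBelow a l := by
      have key : ∀ b, m.countP (fun c => b < c ∧ c < a) = 0 := by
        intro b
        rw [List.countP_eq_zero]
        intro c hc
        have := h.1 c hc
        simp only [decide_eq_true_eq]
        omega
      cases l with
      | cons b l => simp [headBelow, List.countP_append, -Bool.decide_and, key]
      | nil =>
        cases m with
        | nil => rfl
        | cons b m =>
          simp only [List.nil_append, headBelow]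
          exact List.countP_eq_zero.2 fun c hc => by
            have := h.1 c (by simp [hc])
            simp only [decide_eq_true_eq]
            omega
    simp only [List.cons_append, word31_2, ih h.2, hd]
    ring

theorem headAbove_eq_lowTail {a : ℕ} {l : List ℕ} (h : ∀ x ∈ l, a < x) :
    headAbove a l = lowTail l := by
  cases l with
  | nil => rfl
  | cons b l =>
    refine List.countP_congr fun c hc => ?_
    have := h c (by simp [hc])
    simp [this]

theorem headBelow_eq_highTail {a : ℕ} {l : List ℕ} (h : ∀ x ∈ l, x < a) :
    headBelow a l = highTail l := by
  cases l with
  | nil => rfl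
  | cons b l =>
    refine List.countP_congr fun c hc => ?_
    have := h c (by simp [hc])
    simp [this]

theorem headAbove_append_of_ne_nil {a : ℕ} {l m : List ℕ} (hl : l ≠ [])
    (h : ∀ x ∈ l, ∀ y ∈ m, x < y) : headAbove a (l ++ m) = headAbove a l := by
  cases l with
  | nil => exact absurd rfl hl
  | cons b l =>
    have : m.countP (fun c => a < c ∧ c < b) = 0 := List.countP_eq_zero.2 fun c hc => by
      have := h b (by simp) c hc
      simp only [decide_eq_true_eq]
      omega
    simp [headAbove, List.countP_append, -Bool.decide_and, this]

/-- The new occurrences all start at the last letter of the left word: it lies below all of `m`, so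
it pairs with the first letter of `m` and every later letter of `m` below that one. The left word
must be nonempty for this. -/
theorem word13_2_append {a : ℕ} {l m : List ℕ} (h : ∀ x ∈ a :: l, ∀ y ∈ m, x < y) :
    word13_2 (a :: l ++ m) = word13_2 (a :: l) + lowTail m + word13_2 m := by
  induction l generalizing a with
  | nil =>
    simp only [List.mem_singleton, forall_eq] at h
    have : headAbove a [] = 0 := rfl
    simp [word13_2, headAbove_eq_lowTail h, this]
  | cons b l ih =>
    simp only [List.mem_cons, forall_eq_or_imp] at h
    have e := headAbove_append_of_ne_nil (a := a) (l := b :: l) (m := m) (by simp)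
      (by simpa using h.2)
    have := ih (a := b) (by simpa using h.2)
    rw [List.cons_append, word13_2, e, this, word13_2.eq_def (a :: b :: l)]
    ring

/-- Letters below the running maximum are not left-to-right maxima, so they impose no condition. -/
theorem wordCoder_append {M : ℕ} {l m : List ℕ} (h : ∀ x ∈ l, x < M) :
    WordCoder M (l ++ m) ↔ WordCoder M m := by
  induction l with
  | nil => rfl
  | cons a l ih =>
    simp only [List.mem_cons, forall_eq_or_imp] at h
    rw [List.cons_append, WordCoder, max_eq_left h.1.le, ih h.2]
    simp [h.1]

theorem wordCoder_congr {M : ℕ} {l : List ℕ} (h : ∀ x ∈ l, M ≤ x) :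
    WordCoder M l ↔ WordCoder 0 l := by
  cases l with
  | nil => simp [WordCoder]
  | cons a l => simp [WordCoder, h a (by simp)]

/-- Since a `WordAlt` word ends in a valley, the ascent at the junction continues the alternation,
and a descent must come next. -/
theorem wordAlt_append {up : Bool} {a : ℕ} {l m : List ℕ} (h : ∀ x ∈ a :: l, ∀ y ∈ m, x < y) :
    WordAlt up (a :: l ++ m) ↔ WordAlt up (a :: l) ∧ WordAlt false m := by
  induction l generalizing a up with
  | nil =>
    have : ¬ DescHead a m := by
      cases m with
      | nil => exact not_false
      | cons b m => exact not_lt_of_gt (h a (by simp) b (by simp))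
    have h₀ : ¬ DescHead a [] := not_false
    cases up <;> simp [WordAlt, this, h₀]
  | cons b l ih =>
    have := fun up => ih (up := up) (a := b) fun x hx => h x (by simp [List.mem_cons.1 hx])
    rw [List.cons_append] at this
    cases up <;> simp only [List.cons_append, WordAlt.eq_2, WordAlt.eq_3, this, DescHead, and_assoc]

/-! ### The statistics on words of trees -/

/-- The number of nodes with a left child. -/
def treeDes : BinaryTree Unit → ℕ
  | .nil => 0
  | .node _ l r => (if l = .nil then 0 else 1) + treeDes l + treeDes r

/-- At a node, the root and the first letter of `l` play 3 and 1; the letters between them in value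
form the right subtree of `l`. -/
def tree31_2 : BinaryTree Unit → ℕ
  | .nil => 0
  | .node _ l r => (tree31_2 l + l.right.numNodes) + tree31_2 r

/-- The letter just before the word of `r` (the root, or the last letter of `l`) plays 1 and the
first letter of `r` plays 3, so the left subtree of `r` supplies the 2s. -/
def tree13_2 : BinaryTree Unit → ℕ
  | .nil => 0
  | .node _ l r => tree13_2 l + (tree13_2 r + r.left.numNodes)

/-- All nodes on the right spine have a left child. -/
def TreeCoder : BinaryTree Unit → Prop
  | .nil => True
  | .node _ l r => l ≠ .nil ∧ TreeCoder r

/-- In the last case `l` is automatically nonempty, since `TreeAlt true .nil` is false. -/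
def TreeAlt : Bool → BinaryTree Unit → Prop
  | up, .nil => up = false
  | true, .node _ l r => l = .nil ∧ TreeAlt false r
  | false, .node _ l r => TreeAlt true l ∧ TreeAlt false r

theorem treeWord_cons_lt {s : ℕ} {l r : BinaryTree Unit} :
    ∀ x ∈ treeWord (s + l.numNodes + 1) r, s + l.numNodes < x := by
  simp only [mem_treeWord]
  omega

theorem treeWord_lt_cons {s : ℕ} {l : BinaryTree Unit} :
    ∀ x ∈ treeWord s l, x < s + l.numNodes := by
  simp only [mem_treeWord]
  omega

theorem lowTail_treeWord (s : ℕ) (t : BinaryTree Unit) :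
    lowTail (treeWord s t) = t.left.numNodes := by
  cases t with
  | nil => rfl
  | node _ l r =>
    rw [treeWord, lowTail, List.countP_append, List.countP_eq_length.2, List.countP_eq_zero.2,
      length_treeWord]
    · rfl
    · intro x hx
      have := treeWord_cons_lt x hx
      simp only [decide_eq_true_eq]
      omega
    · exact fun x hx => decide_eq_true (treeWord_lt_cons x hx)

theorem highTail_treeWord (s : ℕ) (t : BinaryTree Unit) :
    highTail (treeWord s t) = t.right.numNodes := by
  cases t with
  | nil => rfl
  | node _ l r =>
    rw [treeWord, highTail, List.countP_append, List.countP_eq_zero.2, List.countP_eq_length.2,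
      length_treeWord, zero_add]
    · rfl
    · exact fun x hx => decide_eq_true (treeWord_cons_lt x hx)
    · intro x hx
      have := treeWord_lt_cons x hx
      simp only [decide_eq_true_eq]
      omega

theorem descHead_treeWord_append (s : ℕ) (l r : BinaryTree Unit) :
    DescHead (s + l.numNodes) (treeWord s l ++ treeWord (s + l.numNodes + 1) r) ↔ l ≠ .nil := by
  have h := treeWord_lt_cons (s := s) (l := l)
  have h' := treeWord_cons_lt (s := s) (l := l) (r := r)
  cases l with
  | nil =>
    cases r with
    | nil => simp [treeWord, DescHead]
    | node _ l r =>
      have := h' _ (List.mem_cons_self)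
      simp only [treeWord, List.nil_append, DescHead, ne_eq, not_true_eq_false, iff_false]
      simp only [BinaryTree.numNodes] at *
      omega
  | node _ u v =>
    simp [treeWord, DescHead]

theorem wordDes_treeWord (s : ℕ) (t : BinaryTree Unit) : wordDes (treeWord s t) = treeDes t := by
  induction t generalizing s with
  | nil => rfl
  | node _ l r hl hr =>
    simp only [treeWord, wordDes, descHead_treeWord_append, wordDes_append treeWord_lt_treeWord,
      hl, hr, treeDes, ite_not]
    ring

theorem word31_2_treeWord (s : ℕ) (t : BinaryTree Unit) :
    word31_2 (treeWord s t) = tree31_2 t := by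
  induction t generalizing s with
  | nil => rfl
  | node _ l r hl hr =>
    have : headBelow (s + l.numNodes) (treeWord s l ++ treeWord (s + l.numNodes + 1) r) =
        l.right.numNodes := by
      rw [← highTail_treeWord s, ← headBelow_eq_highTail (treeWord_lt_cons (s := s) (l := l))]
      have h' := treeWord_cons_lt (s := s) (l := l) (r := r)
      generalize treeWord (s + l.numNodes + 1) r = m at h'
      have key : ∀ (b : ℕ) (k : List ℕ), (∀ c ∈ k, s + l.numNodes < c) →
          k.countP (fun c => b < c ∧ c < s + l.numNodes) = 0 := by
        intro b k hk
        refine List.countP_eq_zero.2 fun c hc => ?_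
        have := hk c hc
        simp only [decide_eq_true_eq]
        omega
      cases treeWord s l with
      | nil =>
        cases m with
        | nil => rfl
        | cons b m => exact key _ _ fun c hc => h' c (by simp [hc])
      | cons b k => simp [headBelow, List.countP_append, -Bool.decide_and, key b m h']
    simp only [treeWord, word31_2, this, word31_2_append treeWord_lt_treeWord, hl, hr, tree31_2]
    ring

theorem word13_2_treeWord (s : ℕ) (t : BinaryTree Unit) :
    word13_2 (treeWord s t) = tree13_2 t := by
  induction t generalizing s with
  | nil => rfl
  | node _ l r hl hr =>
    have h' := treeWord_lt_treeWord (s := s) (l := l) (r := r)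
    have h₁ := treeWord_cons_lt (s := s) (l := l) (r := r)
    have h₂ := treeWord_lt_cons (s := s) (l := l)
    rw [treeWord, tree13_2, ← hl s, ← hr (s + l.numNodes + 1),
      ← lowTail_treeWord (s + l.numNodes + 1), word13_2]
    generalize treeWord (s + l.numNodes + 1) r = m at *
    cases hw : treeWord s l with
    -- With no left subtree the root itself is adjacent to the right word; otherwise the term comes
    -- from the junction of the two subtree words.
    | nil => simp [word13_2, headAbove_eq_lowTail h₁, add_comm]
    | cons b k =>
      rw [hw] at h' h₂
      rw [word13_2_append h', headAbove_append_of_ne_nil (by simp) h']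
      have : headAbove (s + l.numNodes) (b :: k) = 0 := List.countP_eq_zero.2 fun c _ => by
        have := h₂ b (by simp)
        simp only [decide_eq_true_eq]
        omega
      rw [this]
      ring

theorem wordCoder_treeWord (s : ℕ) (t : BinaryTree Unit) :
    WordCoder 0 (treeWord s t) ↔ TreeCoder t := by
  induction t generalizing s with
  | nil => simp [treeWord, WordCoder, TreeCoder]
  | node _ l r _ hr =>
    rw [treeWord, WordCoder, descHead_treeWord_append, max_eq_right (Nat.zero_le _),
      wordCoder_append treeWord_lt_cons, wordCoder_congr fun x hx => (treeWord_cons_lt x hx).le,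
      hr, TreeCoder]
    simp

theorem wordAlt_treeWord (up : Bool) (s : ℕ) (t : BinaryTree Unit) :
    WordAlt up (treeWord s t) ↔ TreeAlt up t := by
  induction t generalizing s up with
  | nil => simp [treeWord, WordAlt, TreeAlt]
  | node _ l r hl hr =>
    have h' := treeWord_lt_treeWord (s := s) (l := l) (r := r)
    rw [treeWord]
    cases up with
    | true =>
      rw [WordAlt, descHead_treeWord_append, TreeAlt, not_not]
      refine and_congr_right fun h => ?_
      subst h
      exact hr _ _
    | false =>
      rw [WordAlt, descHead_treeWord_append, TreeAlt, ← hl true s]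
      cases l with
      | nil => simp [treeWord, WordAlt]
      | node _ u v =>
        rw [← hr false (s + (BinaryTree.node () u v).numNodes + 1)]
        rw [treeWord] at h' ⊢
        simpa using wordAlt_append (up := true) h'

end PermStat

/-! ### From permutation statistics to word statistics; reversal -/

namespace PermStat

/-- The letter following position `i` of `f`, or `T` at the last position. -/
def nextLetter {n : ℕ} (T : ℕ) (f : Fin n → ℕ) (i : Fin n) : ℕ :=
  if h : (i : ℕ) + 1 < n then f ⟨i + 1, h⟩ else T

theorem nextLetter_succ {n : ℕ} (T : ℕ) (f : Fin (n + 1) → ℕ) (i : Fin n) :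
    nextLetter T f i.succ = nextLetter T (fun j => f j.succ) i := by
  simp [nextLetter]

theorem nextLetter_zero {n : ℕ} (T : ℕ) (f : Fin (n + 2) → ℕ) :
    nextLetter T f 0 = f 1 := by
  simp [nextLetter]

theorem nextLetter_zero_lt {n T : ℕ} {f : Fin (n + 1) → ℕ} (hT : ∀ i, f i ≤ T) :
    nextLetter T f 0 < f 0 ↔ DescHead (f 0) (List.ofFn fun i : Fin n => f i.succ) := by
  cases n with
  | zero => simp [nextLetter, DescHead, hT]
  | succ n => simp [nextLetter_zero, List.ofFn_succ, DescHead]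

theorem lt_nextLetter_zero {n T : ℕ} {f : Fin (n + 1) → ℕ} (hT : ∀ i, f i < T)
    (hf : Function.Injective f) :
    f 0 < nextLetter T f 0 ↔ ¬ DescHead (f 0) (List.ofFn fun i : Fin n => f i.succ) := by
  rw [← nextLetter_zero_lt fun i => (hT i).le, not_lt]
  refine ⟨le_of_lt, fun h => lt_of_le_of_ne h ?_⟩
  cases n with
  | zero => simpa [nextLetter] using (hT 0).ne
  | succ n =>
    rw [nextLetter_zero]
    exact hf.ne (by simp)

theorem countP_ofFn_eq_sum {n : ℕ} (f : Fin n → ℕ) (p : ℕ → Prop) [DecidablePred p] :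
    (List.ofFn f).countP p = ∑ i, if p (f i) then 1 else 0 := by
  induction n with
  | zero => simp
  | succ n ih => simp [List.ofFn_succ, List.countP_cons, ih, Fin.sum_univ_succ, add_comm, -Finset.sum_boole]

theorem des_eq_wordDes {n : ℕ} (π : Equiv.Perm (Fin n)) : des π = wordDes (word π) := by
  -- The final letter `T` is decoupled from the length so that the induction can drop the first
  -- letter.
  have key : ∀ (n T : ℕ) (f : Fin n → ℕ), (∀ i, f i ≤ T) →
      ∑ i, (if nextLetter T f i < f i then 1 else 0) = wordDes (List.ofFn f) := by
    intro n T
    induction n with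
    | zero => simp [wordDes]
    | succ n ih =>
      intro f hf
      rw [Fin.sum_univ_succ, List.ofFn_succ, wordDes, ← ih _ fun i => hf i.succ]
      simp only [nextLetter_succ, nextLetter_zero_lt hf]
  rw [word, ← key n n _ fun i => (π i).2.le, des, Finset.card_filter]
  rfl

theorem sum_headBelow {n T : ℕ} (f : Fin (n + 1) → ℕ) :
    (∑ j : Fin (n + 1), if (0 : ℕ) + 1 < j ∧ nextLetter T f 0 < f j ∧ f j < f 0 then 1 else 0) =
      headBelow (f 0) (List.ofFn fun i : Fin n => f i.succ) := by
  cases n with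
  | zero => simp [headBelow]
  | succ n =>
    rw [List.ofFn_succ, headBelow, countP_ofFn_eq_sum, Fin.sum_univ_succ, Fin.sum_univ_succ]
    simp [nextLetter_zero, -Finset.sum_boole]
    rfl

theorem sum_headAbove {n T : ℕ} (f : Fin (n + 1) → ℕ) :
    (∑ j : Fin (n + 1), if (0 : ℕ) + 1 < j ∧ f 0 < f j ∧ f j < nextLetter T f 0 then 1 else 0) =
      headAbove (f 0) (List.ofFn fun i : Fin n => f i.succ) := by
  cases n with
  | zero => simp [headAbove]
  | succ n =>
    rw [List.ofFn_succ, headAbove, countP_ofFn_eq_sum, Fin.sum_univ_succ, Fin.sum_univ_succ]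
    simp [nextLetter_zero, -Finset.sum_boole]
    rfl

theorem vinc31_2_eq_word31_2 {n : ℕ} (π : Equiv.Perm (Fin n)) :
    vinc31_2 π = word31_2 (word π) := by
  have key : ∀ (n T : ℕ) (f : Fin n → ℕ),
      ∑ i : Fin n, ∑ j : Fin n,
        (if (i : ℕ) + 1 < j ∧ nextLetter T f i < f j ∧ f j < f i then 1 else 0) =
      word31_2 (List.ofFn f) := by
    intro n T
    induction n with
    | zero => simp [word31_2]
    | succ n ih =>
      intro f
      rw [Fin.sum_univ_succ, List.ofFn_succ, word31_2, ← ih, ← sum_headBelow (T := T)]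
      congr 1
      refine Finset.sum_congr rfl fun i _ => ?_
      rw [Fin.sum_univ_succ]
      simp [nextLetter_succ]
  rw [word, ← key n n, vinc31_2, Finset.card_filter, Fintype.sum_prod_type]
  rfl

theorem vinc13_2_eq_word13_2 {n : ℕ} (π : Equiv.Perm (Fin n)) :
    vinc13_2 π = word13_2 (word π) := by
  have key : ∀ (n T : ℕ) (f : Fin n → ℕ),
      ∑ i : Fin n, ∑ j : Fin n,
        (if (i : ℕ) + 1 < j ∧ f i < f j ∧ f j < nextLetter T f i then 1 else 0) =
      word13_2 (List.ofFn f) := by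
    intro n T
    induction n with
    | zero => simp [word13_2]
    | succ n ih =>
      intro f
      rw [Fin.sum_univ_succ, List.ofFn_succ, word13_2, ← ih, ← sum_headAbove (T := T)]
      congr 1
      refine Finset.sum_congr rfl fun i _ => ?_
      rw [Fin.sum_univ_succ]
      simp [nextLetter_succ]
  rw [word, ← key n n, vinc13_2, Finset.card_filter, Fintype.sum_prod_type]
  rfl

theorem fmax_eq_zero_iff {n : ℕ} (π : Equiv.Perm (Fin n)) :
    fmax π = 0 ↔ WordCoder 0 (word π) := by
  -- The threshold `m` remembers the maximum of the letters already removed.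
  have key : ∀ (n T m : ℕ) (f : Fin n → ℕ), (∀ i, f i < T) → Function.Injective f →
      (WordCoder m (List.ofFn f) ↔
        ∀ i, (∀ j ≤ i, f j ≤ f i) → m ≤ f i → ¬ f i < nextLetter T f i) := by
    intro n T
    induction n with
    | zero => simp [WordCoder]
    | succ n ih =>
      intro m f hT hf
      rw [List.ofFn_succ, WordCoder, Fin.forall_fin_succ,
        ih _ _ (fun i => hT i.succ) (hf.comp (Fin.succ_injective _)), lt_nextLetter_zero hT hf]
      simp only [nextLetter_succ, Fin.forall_fin_succ, max_le_iff, not_not, Fin.succ_le_succ_iff]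
      refine and_congr (by simp) (forall_congr' fun i => ?_)
      simp only [Fin.zero_le, forall_const]
      tauto
  rw [word, key n n 0 _ (fun i => (π i).2) (Fin.val_injective.comp π.injective), fmax,
    Finset.card_eq_zero, Finset.filter_eq_empty_iff]
  simp only [Finset.mem_univ, forall_const, not_and, Nat.zero_le, Fin.val_fin_le]
  rfl

/-- The requirement that the last letter be a valley is equivalent to the parity condition on the
length. -/
theorem wordAlt_ofFn {n : ℕ} (up : Bool) (f : Fin n → ℕ) (hf : Function.Injective f) :
    WordAlt up (List.ofFn f) ↔ (up = true ↔ Odd n) ∧ ∀ (k : ℕ) (h : k + 1 < n),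
      if (Even k ↔ up = false) then f ⟨k + 1, h⟩ < f ⟨k, by omega⟩
      else f ⟨k, by omega⟩ < f ⟨k + 1, h⟩ := by
  induction n generalizing up with
  | zero => simp [WordAlt]
  | succ n ih =>
    have ih' := fun up => ih up (fun i => f i.succ) (hf.comp (Fin.succ_injective _))
    rw [List.ofFn_succ]
    cases n with
    | zero => cases up <;> simp [WordAlt, DescHead]
    | succ n =>
      have h01 : f 0 ≠ f 1 := hf.ne (by simp)
      have hd : DescHead (f 0) (List.ofFn fun i : Fin (n + 1) => f i.succ) ↔ f 1 < f 0 := by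
        simp [List.ofFn_succ, DescHead]
      have hsplit : ∀ P : ∀ k, k + 1 < n + 1 + 1 → Prop,
          (∀ k h, P k h) ↔ P 0 (by omega) ∧ ∀ k (h : k + 1 < n + 1), P (k + 1) (by omega) := by
        intro P
        refine ⟨fun h => ⟨h _ _, fun k hk => h _ _⟩, fun h k hk => ?_⟩
        cases k with
        | zero => exact h.1
        | succ k => exact h.2 k (by omega)
      rw [hsplit]
      cases up with
      | true =>
        rw [WordAlt, hd, ih']
        simp [Nat.odd_add_one, Nat.even_add_one, not_lt, h01.le_iff_lt]
        tauto
      | false =>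
        rw [WordAlt, hd, ih']
        simp [Nat.odd_add_one, Nat.even_add_one]
        tauto

theorem avoids_132_mul_revPerm {n : ℕ} (π : Equiv.Perm (Fin n)) :
    Avoids (π * Fin.revPerm) ![1, 3, 2] ↔ Avoids π ![2, 3, 1] := by
  simp only [avoids_132_iff, avoids_231_iff, Equiv.Perm.mul_apply, Fin.revPerm_apply]
  constructor
  · intro h i j k hij hjk
    simpa using h k.rev j.rev i.rev (by simpa) (by simpa)
  · intro h i j k hij hjk
    simpa using h k.rev j.rev i.rev (by simpa) (by simpa)

theorem vinc2_31_mul_revPerm {n : ℕ} (π : Equiv.Perm (Fin n)) :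
    vinc2_31 (π * Fin.revPerm) = vinc13_2 π := by
  -- Reversal sends the adjacent pair starting at `i` to the one starting at `n - 2 - i`; the last
  -- position starts no pair, and its value is a dummy.
  let g : Fin n → Fin n := fun i => if h : (i : ℕ) + 1 < n then (⟨i + 1, h⟩ : Fin n).rev else i
  have hg : ∀ i : Fin n, (i : ℕ) + 1 < n → (g i : ℕ) + 1 + i + 1 = n := by
    intro i h
    simp only [g, h, dif_pos, Fin.val_rev]
    omega
  have hgg : ∀ i : Fin n, (i : ℕ) + 1 < n → g (g i) = i := by
    intro i h
    have h₁ := hg i h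
    have h₂ := hg (g i) (by omega)
    exact Fin.ext (by omega)
  have hnext : ∀ (σ : Equiv.Perm (Fin n)) (i : Fin n), (i : ℕ) + 1 < n →
      next σ i = σ (g i).rev := by
    intro σ i h
    simp [next, g, h]
  have hrev : ∀ i : Fin n, (i : ℕ) + 1 < n → next (π * Fin.revPerm) (g i) = π i := by
    intro i h
    have h₁ := hg i h
    rw [hnext _ _ (by omega), hgg i h]
    simp
  refine (Finset.card_nbij' (fun x => (g x.1, x.2.rev)) (fun x => (g x.1, x.2.rev))
    ?_ ?_ ?_ ?_).symm
  · rintro ⟨i, j⟩ h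
    simp only [Finset.coe_filter, Finset.mem_univ, true_and, Set.mem_ofPred_eq] at h ⊢
    have hi : (i : ℕ) + 1 < n := by omega
    have h₁ := hg i hi
    rw [hnext π i hi] at h
    rw [hrev i hi]
    refine ⟨?_, by omega, ?_, ?_⟩
    · rw [Fin.lt_def, Fin.val_rev]; omega
    · simpa using h.2.1
    · simpa using h.2.2
  · rintro ⟨i, j⟩ h
    simp only [Finset.coe_filter, Finset.mem_univ, true_and, Set.mem_ofPred_eq] at h ⊢
    have h₁ := hg i h.2.1
    have h₂ := hrev (g i) (by omega)
    rw [hgg i h.2.1] at h₂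
    rw [h₂] at h
    rw [hnext π _ (by omega), hgg i h.2.1]
    refine ⟨?_, ?_, ?_⟩
    · rw [Fin.val_rev]; omega
    · simpa using h.2.2.1
    · simpa using h.2.2.2
  · rintro ⟨i, j⟩ h
    simp only [Finset.coe_filter, Finset.mem_univ, true_and, Set.mem_ofPred_eq] at h
    simp [hgg i (by omega)]
  · rintro ⟨i, j⟩ h
    simp only [Finset.coe_filter, Finset.mem_univ, true_and, Set.mem_ofPred_eq] at h
    simp [hgg i h.2.1]

/-- In even length an up-down word begins and ends with an ascent, so its reverse begins and ends
with a descent. -/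
theorem isAlternating_mul_revPerm {m : ℕ} (π : Equiv.Perm (Fin (2 * m))) :
    IsAlternating (π * Fin.revPerm) ↔ WordAlt false (word π) := by
  rw [word, wordAlt_ofFn _ (fun i => (π i : ℕ)) (Fin.val_injective.comp π.injective), IsAlternating]
  have hrev : ∀ (k : ℕ) (h : k < 2 * m), (⟨k, h⟩ : Fin (2 * m)).rev = ⟨2 * m - 1 - k, by omega⟩ :=
    fun k h => Fin.ext (by simp [Fin.val_rev]; omega)
  simp only [Nat.not_odd_iff_even.2 (even_two_mul m), Bool.false_eq_true, true_and, iff_true]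
  have hpar : ∀ k, k + 1 < 2 * m → (Even (2 * m - 2 - k) ↔ Even k) := by
    intro k hk
    simp only [Nat.even_iff]
    omega
  constructor
  · intro h k hk
    have := h ⟨2 * m - 2 - k, by omega⟩ (by simp only; omega)
    have e₁ : 2 * m - 1 - (2 * m - 2 - k) = k + 1 := by omega
    have e₂ : 2 * m - 1 - (2 * m - 2 - k + 1) = k := by omega
    have e₃ : 2 * m - 2 - k + 1 < 2 * m := by omega
    simpa only [next, e₃, dif_pos, Equiv.Perm.mul_apply, Fin.revPerm_apply, hrev, e₁, e₂,
      hpar k hk] using this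
  · rintro h ⟨k, hk'⟩ hk
    simp only at hk
    have := h (2 * m - 2 - k) (by omega)
    have e₁ : 2 * m - 2 - k + 1 = 2 * m - 1 - k := by omega
    have e₂ : 2 * m - 2 - k = 2 * m - 1 - (k + 1) := by omega
    simp only [hpar k hk, e₁] at this
    simp only [next, hk, dif_pos, Equiv.Perm.mul_apply, Fin.revPerm_apply, hrev, ← e₂]
    exact this

end PermStat

/-! ### Carlitz's series and the functional equations -/

namespace ContFrac

open PowerSeries

variable {R : Type*} [CommRing R]

/-- Finite convergents satisfy the recursion exactly, and they agree with the limit modulo every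
power of `X`. -/
theorem stieltjes_eq (c : ℕ → R) :
    stieltjes c = 1 + C (c 0) * X * stieltjes (fun k => c (k + 1)) * stieltjes c := by
  have h : ∀ n, (X : R⟦X⟧) ^ n ∣
      (1 - C (c 0) * X * stieltjes (fun k => c (k + 1))) * stieltjes c - 1 := by
    intro n
    have hd : ∀ c : ℕ → R, ∀ m, n ≤ m → (X : R⟦X⟧) ^ n ∣ stieltjes c - convergent m c := by
      intro c m hm
      rw [X_pow_dvd_iff]
      intro k hk
      rw [map_sub, coeff_convergent (by omega), sub_self]
    have h₁ := hd c (n + 1) (by omega)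
    have h₂ := hd (fun k => c (k + 1)) n le_rfl
    have h₃ := convergent_succ_mul n c
    have : (1 - C (c 0) * X * stieltjes (fun k => c (k + 1))) * stieltjes c - 1 =
        (1 - C (c 0) * X * stieltjes (fun k => c (k + 1))) *
          (stieltjes c - convergent (n + 1) c) -
        (stieltjes (fun k => c (k + 1)) - convergent n (fun k => c (k + 1))) *
          (C (c 0) * X * convergent (n + 1) c) := by
      linear_combination h₃
    rw [this]
    exact dvd_sub (h₁.mul_left _) (h₂.mul_right _)
  have h₀ : (1 - C (c 0) * X * stieltjes (fun k => c (k + 1))) * stieltjes c - 1 = 0 := by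
    ext n
    exact X_pow_dvd_iff.1 (h (n + 1)) n (by omega)
  linear_combination h₀

theorem convergent_mul_left (r : R) (m : ℕ) (c : ℕ → R) :
    convergent m (fun k => r * c k) = rescale r (convergent m c) := by
  induction m generalizing c with
  | zero => simp [convergent]
  | succ m ih =>
    have h₁ := convergent_succ_mul m (fun k => r * c k)
    have h₂ := congrArg (rescale r) (convergent_succ_mul m c)
    simp only [ih (fun k => c (k + 1)), map_mul, map_sub, map_one, rescale_X] at h₁ h₂
    have e : rescale r (C (c 0)) = C (c 0) := by
      ext n
      rw [coeff_rescale, coeff_C]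
      split_ifs with h <;> simp [h]
    rw [e] at h₂
    linear_combination (rescale r (convergent (m + 1) c)) * h₁ -
      convergent (m + 1) (fun k => r * c k) * h₂

theorem stieltjes_mul_left (r : R) (c : ℕ → R) :
    stieltjes (fun k => r * c k) = rescale r (stieltjes c) := by
  ext n
  rw [← coeff_convergent le_rfl, convergent_mul_left, coeff_rescale, coeff_rescale,
    coeff_convergent le_rfl]

/-- The generating function of Carlitz's `q`-Catalan numbers. -/
noncomputable def carlitzSeries (q : R) : R⟦X⟧ := stieltjes fun k => q ^ k

theorem coeff_carlitzSeries (n : ℕ) (q : R) : coeff n (carlitzSeries q) = carlitzCatalan n q := by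
  rw [carlitzSeries, carlitzCatalan, qtCatalan]
  congr 2
  ext k
  split_ifs with h
  · rw [← pow_mul, Nat.two_mul_div_two_of_even h]
  · rw [← pow_mul, ← pow_succ', Nat.two_mul_div_two_add_one_of_odd (Nat.not_even_iff_odd.1 h)]

/-- Dropping the first coefficient of `1, q, q², …` multiplies the sequence by `q`, which amounts to
`z ↦ q z`. -/
theorem carlitzSeries_eq (q : R) :
    carlitzSeries q = 1 + X * rescale q (carlitzSeries q) * carlitzSeries q := by
  have h := stieltjes_eq fun k => q ^ k
  have e : (fun k => q ^ (k + 1)) = fun k => q * q ^ k := by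
    ext k
    rw [pow_succ']
  rw [e, stieltjes_mul_left] at h
  simpa [carlitzSeries] using h

theorem rescale_C (q r : R) : rescale q (C r) = C r := by
  ext n
  rw [coeff_rescale, coeff_C]
  split_ifs with h <;> simp [h]

theorem rescale_expand_two (q : R) (f : R⟦X⟧) :
    rescale q (expand 2 two_ne_zero f) = expand 2 two_ne_zero (rescale (q ^ 2) f) := by
  ext n
  rw [coeff_rescale, coeff_expand, coeff_expand]
  split_ifs with h
  · rw [coeff_rescale, ← pow_mul, Nat.mul_div_cancel' h]
  · simp

/-- The series `∑ (s q) ^ m C_m(q ^ 2) z ^ (2 m)`. -/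
noncomputable def evenCarlitz (s q : R) : R⟦X⟧ :=
  expand 2 two_ne_zero (rescale (s * q) (carlitzSeries (q ^ 2)))

theorem evenCarlitz_eq (s q : R) :
    evenCarlitz s q =
      1 + C (s * q) * X ^ 2 * rescale q (evenCarlitz s q) * evenCarlitz s q := by
  have h := congrArg (fun f => expand 2 two_ne_zero (rescale (s * q) f))
    (carlitzSeries_eq (q ^ 2))
  simp only [map_add, map_mul, map_one, rescale_X, expand_X, expand_C] at h
  have e : rescale q (evenCarlitz s q) =
      expand 2 two_ne_zero (rescale (s * q) (rescale (q ^ 2) (carlitzSeries (q ^ 2)))) := by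
    rw [evenCarlitz, rescale_expand_two, rescale_rescale, rescale_rescale, mul_comm]
  rw [e, map_mul]
  exact h

theorem coeff_evenCarlitz (s q : R) (n : ℕ) : coeff n (evenCarlitz s q) =
    if Even n then (s * q) ^ (n / 2) * carlitzCatalan (n / 2) (q ^ 2) else 0 := by
  rw [evenCarlitz, coeff_expand]
  simp only [even_iff_two_dvd, coeff_rescale, coeff_carlitzSeries]

/-- A contraction in the `X`-adic topology: divisibility of `f - g` by `X ^ n` improves to `X ^ (n +
1)`, since `rescale q` preserves it. -/
theorem eq_of_sub_eq_X_mul {q : R} {f g u v : R⟦X⟧}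
    (h : f - g = X * (u * (f - g) + v * rescale q (f - g))) : f = g := by
  have hd : ∀ n, (X : R⟦X⟧) ^ n ∣ f - g := by
    intro n
    induction n with
    | zero => simp
    | succ n ih =>
      have ih' : (X : R⟦X⟧) ^ n ∣ rescale q (f - g) := by
        rw [X_pow_dvd_iff] at ih ⊢
        intro m hm
        rw [coeff_rescale, ih m hm, mul_zero]
      rw [h, pow_succ']
      exact mul_dvd_mul_left _ (dvd_add (ih.mul_left _) (ih'.mul_left _))
  rw [← sub_eq_zero]
  ext n
  exact X_pow_dvd_iff.1 (hd (n + 1)) n (by omega)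

theorem eq_of_functional_eq {q : R} {e f g : R⟦X⟧}
    (hf : f * (1 + e * X * rescale q f - e * X) = 1 + e * X * rescale q f)
    (hg : g * (1 + e * X * rescale q g - e * X) = 1 + e * X * rescale q g) : f = g := by
  refine eq_of_sub_eq_X_mul (q := q) (u := e * (1 - rescale q f)) (v := e * (1 - g)) ?_
  rw [map_sub]
  linear_combination hf - hg

/-- For `f = 1 + e z E`, the condition `e² = 1` gives `e z f(q z) = e z + q z² E(q z)`, so the
equation reduces to `E (1 + q z² E(q z)) = 1`. -/
theorem evenCarlitz_functional_eq (q : R) {e : R} (he : e ^ 2 = 1) :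
    (1 + C e * X * evenCarlitz (-1) q) *
        (1 + C e * X * rescale q (1 + C e * X * evenCarlitz (-1) q) - C e * X) =
      1 + C e * X * rescale q (1 + C e * X * evenCarlitz (-1) q) := by
  have h := evenCarlitz_eq (-1) q
  have he' : (C e : R⟦X⟧) ^ 2 = 1 := by rw [← map_pow, he, map_one]
  simp only [map_add, map_mul, map_one, rescale_X, rescale_C, map_neg] at h ⊢
  linear_combination C e * X * h + (C e * X * evenCarlitz (-1) q) * (C q * X ^ 2 *
    rescale q (evenCarlitz (-1) q)) * he'

end ContFrac

/-! ### Generating functions of binary trees -/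

namespace PermStat

open PowerSeries BinaryTree ContFrac

variable {R : Type*} [CommRing R]

/-- The generating function of binary trees by number of nodes with weight `w`. -/
noncomputable def treeSeries (w : BinaryTree Unit → R) : R⟦X⟧ :=
  mk fun n => ∑ t ∈ treesOfNumNodesEq n, w t

/-- Splitting at the root: a weight factoring over the two subtrees gives a Cauchy product, with `X`
for the root. -/
theorem treeSeries_eq {w u v : BinaryTree Unit → R}
    (hw : ∀ l r, w (.node () l r) = u l * v r) :
    treeSeries w = C (w .nil) + X * treeSeries u * treeSeries v := by
  ext n
  cases n with
  | zero => simp [treeSeries]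
  | succ n =>
    rw [map_add, coeff_C, if_neg (Nat.succ_ne_zero n), zero_add, mul_assoc, coeff_succ_X_mul,
      coeff_mul]
    simp only [treeSeries, coeff_mk]
    rw [treesOfNumNodesEq_succ, Finset.sum_biUnion]
    · refine Finset.sum_congr rfl fun ij _ => ?_
      rw [pairwiseNode, Finset.sum_map, Finset.sum_product, Finset.sum_mul_sum]
      exact Finset.sum_congr rfl fun l _ => Finset.sum_congr rfl fun r _ => hw l r
    · rintro ⟨i, j⟩ _ ⟨i', j'⟩ _ hne
      rw [Function.onFun, Finset.disjoint_left]
      intro t ht ht'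
      simp only [pairwiseNode, Finset.mem_map, Finset.mem_product, mem_treesOfNumNodesEq,
        Prod.exists] at ht ht'
      obtain ⟨a, b, ⟨ha, hb⟩, rfl⟩ := ht
      obtain ⟨a', b', ⟨ha', hb'⟩, h⟩ := ht'
      simp at h
      exact hne (by rw [← ha, ← hb, ← ha', ← hb', h.1, h.2])

theorem treeSeries_pow_numNodes_mul (q : R) (w : BinaryTree Unit → R) :
    treeSeries (fun t => q ^ t.numNodes * w t) = rescale q (treeSeries w) := by
  ext n
  simp only [treeSeries, coeff_mk, coeff_rescale, Finset.mul_sum]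
  refine Finset.sum_congr rfl fun t ht => ?_
  rw [mem_treesOfNumNodesEq.1 ht]

/-- The weight `w`, with a factor `x` on nonempty trees and value `c` on the empty tree. -/
def nodeWeight (c x : R) (w : BinaryTree Unit → R) (t : BinaryTree Unit) : R :=
  if t = .nil then c else x * w t

/-- Used for left subtrees: `x` marks the descent at the root, while `c = 1` allows and `c = 0`
forbids an empty left subtree. -/
theorem treeSeries_nodeWeight (c x : R) {w : BinaryTree Unit → R} (hw : w .nil = 1) :
    treeSeries (nodeWeight c x w) = C c + C x * (treeSeries w - 1) := by
  ext n
  cases n with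
  | zero => simp [treeSeries, nodeWeight, hw]
  | succ n =>
    simp only [treeSeries, coeff_mk, map_add, map_sub, coeff_C_mul, coeff_C, coeff_one,
      Nat.succ_ne_zero, if_false, zero_add, sub_zero, Finset.mul_sum]
    refine Finset.sum_congr rfl fun t ht => if_neg ?_
    rintro rfl
    simp [mem_treesOfNumNodesEq] at ht

end PermStat

/-! ### Weights of the statistics and their specialisations -/

namespace PermStat

open PowerSeries BinaryTree ContFrac

variable {R : Type*} [CommRing R]

def weight31 (x q : R) (t : BinaryTree Unit) : R := x ^ treeDes t * q ^ tree31_2 t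

/-- The weight of `weight31` for the word preceded by an infinite letter. -/
def weight31' (x q : R) (t : BinaryTree Unit) : R :=
  x ^ treeDes t * q ^ (tree31_2 t + t.right.numNodes)

def weight13 (x q : R) (t : BinaryTree Unit) : R := x ^ treeDes t * q ^ tree13_2 t

/-- The weight of `weight13` for the word preceded by a letter smaller than all others. -/
def weight13' (x q : R) (t : BinaryTree Unit) : R :=
  x ^ treeDes t * q ^ (tree13_2 t + t.left.numNodes)

open Classical in
/-- The weight `w` restricted to the trees with the property `p`. -/
noncomputable def restrict (p : BinaryTree Unit → Prop) (w : BinaryTree Unit → R)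
    (t : BinaryTree Unit) : R :=
  if p t then w t else 0

theorem sum_permAvoiding_weight31 (x q : R) (n : ℕ) :
    ∑ π ∈ permAvoiding n ![2, 3, 1], x ^ des π * q ^ vinc31_2 π =
      coeff n (treeSeries (weight31 x q)) := by
  simp only [des_eq_wordDes, vinc31_2_eq_word31_2]
  rw [sum_permAvoiding_231 n fun l => x ^ wordDes l * q ^ word31_2 l]
  simp only [wordDes_treeWord, word31_2_treeWord, treeSeries, coeff_mk, weight31]

theorem sum_permAvoiding_weight13 (x q : R) (n : ℕ) :
    ∑ π ∈ permAvoiding n ![2, 3, 1], x ^ des π * q ^ vinc13_2 π =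
      coeff n (treeSeries (weight13 x q)) := by
  simp only [des_eq_wordDes, vinc13_2_eq_word13_2]
  rw [sum_permAvoiding_231 n fun l => x ^ wordDes l * q ^ word13_2 l]
  simp only [wordDes_treeWord, word13_2_treeWord, treeSeries, coeff_mk, weight13]

open Classical in
theorem sum_coderAvoiding {M : Type*} [AddCommMonoid M] (n : ℕ) (g : List ℕ → M) :
    ∑ π ∈ coderAvoiding n ![2, 3, 1], g (word π) =
      ∑ t ∈ treesOfNumNodesEq n, if TreeCoder t then g (treeWord 0 t) else 0 := by
  have e : coderAvoiding n ![2, 3, 1] =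
      (permAvoiding n ![2, 3, 1]).filter fun π => WordCoder 0 (word π) := by
    ext π
    simp [coderAvoiding, permAvoiding, fmax_eq_zero_iff, and_comm]
  rw [e, Finset.sum_filter, sum_permAvoiding_231 n fun l => if WordCoder 0 l then g l else 0]
  simp only [wordCoder_treeWord]

theorem sum_coderAvoiding_weight31 (x q : R) (n : ℕ) :
    ∑ π ∈ coderAvoiding n ![2, 3, 1], x ^ des π * q ^ vinc31_2 π =
      coeff n (treeSeries (restrict TreeCoder (weight31 x q))) := by
  simp only [des_eq_wordDes, vinc31_2_eq_word31_2]
  rw [sum_coderAvoiding n fun l => x ^ wordDes l * q ^ word31_2 l]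
  simp only [wordDes_treeWord, word31_2_treeWord, treeSeries, coeff_mk, weight31, restrict]

theorem sum_coderAvoiding_weight13 (x q : R) (n : ℕ) :
    ∑ π ∈ coderAvoiding n ![2, 3, 1], x ^ des π * q ^ vinc13_2 π =
      coeff n (treeSeries (restrict TreeCoder (weight13 x q))) := by
  simp only [des_eq_wordDes, vinc13_2_eq_word13_2]
  rw [sum_coderAvoiding n fun l => x ^ wordDes l * q ^ word13_2 l]
  simp only [wordDes_treeWord, word13_2_treeWord, treeSeries, coeff_mk, weight13, restrict]

/-- Reversal turns 132 into 231, `2-31` into `13-2`, and up-down words of even length into `WordAlt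
false` words. -/
theorem cStar_eq (m : ℕ) (q : R) :
    cStar m q = coeff (2 * m) (treeSeries (restrict (TreeAlt false) (weight13 1 q))) := by
  classical
  have e : cStar m q = ∑ π ∈ permAvoiding (2 * m) ![2, 3, 1],
      if WordAlt false (word π) then q ^ word13_2 (word π) else 0 := by
    rw [← Finset.sum_filter, cStar]
    refine (Finset.sum_equiv (Equiv.mulRight Fin.revPerm) (fun π => ?_) fun π _ => ?_).symm
    · simp [altAvoiding, permAvoiding, isAlternating_mul_revPerm, avoids_132_mul_revPerm,
        and_comm]
    · rw [Equiv.coe_mulRight, vinc2_31_mul_revPerm, vinc13_2_eq_word13_2]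
  rw [e, sum_permAvoiding_231 _ fun l => if WordAlt false l then q ^ word13_2 l else 0]
  simp only [wordAlt_treeWord, word13_2_treeWord, treeSeries, coeff_mk, weight13, restrict,
    one_pow, one_mul]

/-! ### Functional equations -/

theorem weight31_nil (x q : R) : weight31 x q .nil = 1 := by
  simp [weight31, treeDes, tree31_2]

theorem weight31'_nil (x q : R) : weight31' x q .nil = 1 := by
  simp [weight31', treeDes, tree31_2, right, numNodes]

theorem weight13_nil (x q : R) : weight13 x q .nil = 1 := by
  simp [weight13, treeDes, tree13_2]

theorem weight13'_nil (x q : R) : weight13' x q .nil = 1 := by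
  simp [weight13', treeDes, tree13_2, left, numNodes]

theorem weight31_node (x q : R) (l r : BinaryTree Unit) :
    weight31 x q (.node () l r) = nodeWeight 1 x (weight31' x q) l * weight31 x q r := by
  by_cases hl : l = .nil
  · subst hl
    simp [weight31, nodeWeight, treeDes, tree31_2, right, numNodes]
  · simp only [weight31, weight31', nodeWeight, treeDes, tree31_2, hl, if_false]
    ring

theorem weight31'_node (x q : R) (l r : BinaryTree Unit) :
    weight31' x q (.node () l r) =
      nodeWeight 1 x (weight31' x q) l * (q ^ r.numNodes * weight31 x q r) := by
  have h := weight31_node x q l r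
  have e : weight31' x q (.node () l r) = q ^ r.numNodes * weight31 x q (.node () l r) := by
    simp only [weight31', weight31, right]
    ring
  rw [e, h]
  ring

theorem weight13_node (x q : R) (l r : BinaryTree Unit) :
    weight13 x q (.node () l r) = nodeWeight 1 x (weight13 x q) l * weight13' x q r := by
  by_cases hl : l = .nil
  · subst hl
    simp [weight13, weight13', nodeWeight, treeDes, tree13_2]
  · simp only [weight13, weight13', nodeWeight, treeDes, tree13_2, hl, if_false]
    ring

theorem weight13'_node (x q : R) (l r : BinaryTree Unit) :
    weight13' x q (.node () l r) =
      (q ^ l.numNodes * nodeWeight 1 x (weight13 x q) l) * weight13' x q r := by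
  have h := weight13_node x q l r
  have e : weight13' x q (.node () l r) = q ^ l.numNodes * weight13 x q (.node () l r) := by
    simp only [weight13', weight13, left]
    ring
  rw [e, h]
  ring

theorem restrict_treeCoder_nil (w : BinaryTree Unit → R) : restrict TreeCoder w .nil = w .nil :=
  if_pos trivial

/-- The coderangement condition only replaces the constant 1 for an empty left subtree by 0. -/
theorem restrict_treeCoder_node {w u v : BinaryTree Unit → R} {x : R} {l r : BinaryTree Unit}
    (h : w (.node () l r) = nodeWeight 1 x u l * v r) :
    restrict TreeCoder w (.node () l r) = nodeWeight 0 x u l * restrict TreeCoder v r := by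
  simp only [restrict, TreeCoder, h, nodeWeight]
  by_cases hl : l = .nil <;> by_cases hr : TreeCoder r <;> simp [hl, hr]

theorem treeSeries_weight31 (x q : R) : treeSeries (weight31 x q) =
    1 + X * (1 + C x * (treeSeries (weight31' x q) - 1)) * treeSeries (weight31 x q) := by
  have h := treeSeries_eq (weight31_node x q)
  rwa [treeSeries_nodeWeight _ _ (weight31'_nil x q), weight31_nil, map_one] at h

theorem treeSeries_weight31' (x q : R) : treeSeries (weight31' x q) =
    1 + X * (1 + C x * (treeSeries (weight31' x q) - 1)) *
      rescale q (treeSeries (weight31 x q)) := by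
  have h := treeSeries_eq (u := nodeWeight 1 x (weight31' x q))
    (v := fun t => q ^ t.numNodes * weight31 x q t) (weight31'_node x q)
  rwa [treeSeries_nodeWeight _ _ (weight31'_nil x q), weight31'_nil,
    treeSeries_pow_numNodes_mul, map_one] at h

theorem treeSeries_weight13 (x q : R) : treeSeries (weight13 x q) =
    1 + X * (1 + C x * (treeSeries (weight13 x q) - 1)) * treeSeries (weight13' x q) := by
  have h := treeSeries_eq (weight13_node x q)
  rwa [treeSeries_nodeWeight _ _ (weight13_nil x q), weight13_nil, map_one] at h

theorem treeSeries_weight13' (x q : R) : treeSeries (weight13' x q) =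
    1 + X * rescale q (1 + C x * (treeSeries (weight13 x q) - 1)) *
      treeSeries (weight13' x q) := by
  have h := treeSeries_eq (u := fun t => q ^ t.numNodes * nodeWeight 1 x (weight13 x q) t)
    (weight13'_node x q)
  rwa [treeSeries_pow_numNodes_mul, treeSeries_nodeWeight _ _ (weight13_nil x q), weight13'_nil,
    map_one] at h

theorem treeSeries_coder_weight31 (x q : R) :
    treeSeries (restrict TreeCoder (weight31 x q)) =
      1 + X * (C x * (treeSeries (weight31' x q) - 1)) *
        treeSeries (restrict TreeCoder (weight31 x q)) := by
  have h := treeSeries_eq fun l r => restrict_treeCoder_node (weight31_node x q l r)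
  rwa [treeSeries_nodeWeight _ _ (weight31'_nil x q), restrict_treeCoder_nil, weight31_nil,
    map_one, map_zero, zero_add] at h

theorem treeSeries_coder_weight13 (x q : R) :
    treeSeries (restrict TreeCoder (weight13 x q)) =
      1 + X * (C x * (treeSeries (weight13 x q) - 1)) *
        treeSeries (restrict TreeCoder (weight13' x q)) := by
  have h := treeSeries_eq fun l r => restrict_treeCoder_node (weight13_node x q l r)
  rwa [treeSeries_nodeWeight _ _ (weight13_nil x q), restrict_treeCoder_nil, weight13_nil,
    map_one, map_zero, zero_add] at h

theorem treeSeries_coder_weight13' (x q : R) :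
    treeSeries (restrict TreeCoder (weight13' x q)) =
      1 + X * rescale q (C x * (treeSeries (weight13 x q) - 1)) *
        treeSeries (restrict TreeCoder (weight13' x q)) := by
  have h := treeSeries_eq (w := restrict TreeCoder (weight13' x q))
    (u := fun t => q ^ t.numNodes * nodeWeight 0 x (weight13 x q) t)
    (v := restrict TreeCoder (weight13' x q)) fun l r => by
      have h := weight13'_node x q l r
      simp only [restrict, TreeCoder, h, nodeWeight]
      by_cases hl : l = .nil <;> by_cases hr : TreeCoder r <;> simp [hl, hr]
  rwa [treeSeries_pow_numNodes_mul, treeSeries_nodeWeight _ _ (weight13_nil x q),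
    restrict_treeCoder_nil, weight13'_nil, map_one, map_zero, zero_add] at h

theorem nodeWeight_one_one {w : BinaryTree Unit → R} (hw : w .nil = 1) : nodeWeight 1 1 w = w := by
  ext t
  rw [nodeWeight, one_mul]
  split_ifs with h
  · rw [h, hw]
  · rfl

theorem treeSeries_alt_true (q : R) :
    treeSeries (restrict (TreeAlt true) (weight13 1 q)) =
      X * treeSeries (restrict (TreeAlt false) (weight13' 1 q)) := by
  have h := treeSeries_eq (w := restrict (TreeAlt true) (weight13 1 q))
    -- With `c = 1` and `x = 0` this weight is the indicator of the empty left subtree.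
    (u := nodeWeight 1 0 (weight13 1 q))
    (v := restrict (TreeAlt false) (weight13' 1 q)) fun l r => by
      simp only [restrict, TreeAlt, weight13_node, nodeWeight]
      by_cases hl : l = .nil <;> by_cases hr : TreeAlt false r <;> simp [hl, hr]
  rw [treeSeries_nodeWeight _ _ (weight13_nil 1 q)] at h
  simpa [restrict, TreeAlt] using h

theorem treeSeries_alt_false (q : R) :
    treeSeries (restrict (TreeAlt false) (weight13 1 q)) =
      1 + X * treeSeries (restrict (TreeAlt true) (weight13 1 q)) *
        treeSeries (restrict (TreeAlt false) (weight13' 1 q)) := by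
  have h := treeSeries_eq (w := restrict (TreeAlt false) (weight13 1 q))
    (u := restrict (TreeAlt true) (weight13 1 q))
    (v := restrict (TreeAlt false) (weight13' 1 q)) fun l r => by
      simp only [restrict, TreeAlt, weight13_node, nodeWeight_one_one (weight13_nil 1 q)]
      by_cases hl : TreeAlt true l <;> by_cases hr : TreeAlt false r <;> simp [hl, hr]
  simpa [restrict, TreeAlt, weight13_nil] using h

theorem treeSeries_alt_false' (q : R) :
    treeSeries (restrict (TreeAlt false) (weight13' 1 q)) =
      1 + X * rescale q (treeSeries (restrict (TreeAlt true) (weight13 1 q))) *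
        treeSeries (restrict (TreeAlt false) (weight13' 1 q)) := by
  have h := treeSeries_eq (w := restrict (TreeAlt false) (weight13' 1 q))
    (u := fun t => q ^ t.numNodes * restrict (TreeAlt true) (weight13 1 q) t)
    (v := restrict (TreeAlt false) (weight13' 1 q)) fun l r => by
      simp only [restrict, TreeAlt, weight13'_node, nodeWeight_one_one (weight13_nil 1 q)]
      by_cases hl : TreeAlt true l <;> by_cases hr : TreeAlt false r <;> simp [hl, hr]
  rw [treeSeries_pow_numNodes_mul] at h
  simpa [restrict, TreeAlt, weight13'_nil] using h

/-! ### Closed forms -/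

theorem treeSeries_weight31_neg_one (q : R) :
    treeSeries (weight31 (-1) q) = 1 + X * evenCarlitz (-1) q := by
  have hA := treeSeries_weight31 (-1) q
  have hB := treeSeries_weight31' (-1) q
  have hE := evenCarlitz_functional_eq q (one_pow 2 : (1 : R) ^ 2 = 1)
  simp only [map_neg, map_one, one_mul] at hA hB hE
  refine eq_of_functional_eq (q := q) (e := 1) ?_ (by simpa using hE)
  set A := treeSeries (weight31 (-1) q)
  set B := treeSeries (weight31' (-1) q)
  -- Eliminates `B`: the second equation says `(2 - B) (1 + z A(q z)) = 1`, the first `A (1 - z (2 -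
  -- B)) = 1`.
  linear_combination (1 + X * rescale q A) * hA - X * A * hB

theorem treeSeries_weight13_neg_one (q : R) :
    treeSeries (weight13 (-1) q) = 1 + X * evenCarlitz (-1) q := by
  have hA := treeSeries_weight13 (-1) q
  have hB := treeSeries_weight13' (-1) q
  have hE := evenCarlitz_functional_eq q (by ring : (-1 : R) ^ 2 = 1)
  simp only [map_neg, map_one, map_add, map_sub, map_mul] at hA hB hE
  set A := treeSeries (weight13 (-1) q)
  set B := treeSeries (weight13' (-1) q)
  -- Here `2 - A`, rather than `A`, solves the functional equation, with `e = -1`.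
  have : 1 - (A - 1) = 1 + (-1) * X * evenCarlitz (-1) q := by
    refine eq_of_functional_eq (q := q) (e := -1) ?_ (by simpa using hE)
    simp only [map_sub, map_one]
    linear_combination (X * (1 - (rescale q A - 1)) - 1) * hA - X * (1 - (A - 1)) * hB
  linear_combination -this

/-- At `x = -q`, the series `f = 1 + x (B - 1)` solves the functional equation with `e = -q`, as
does the `e = -1` solution after `z ↦ q z`. Hence `B - 1 = z E(q z)`, and the equation of `G`
becomes that of `E`. -/
theorem treeSeries_coder_weight31_neg (q : R) :
    treeSeries (restrict TreeCoder (weight31 (-q) q)) = evenCarlitz (-1) q := by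
  have hA := congrArg (rescale q) (treeSeries_weight31 (-q) q)
  have hB := treeSeries_weight31' (-q) q
  have hG := treeSeries_coder_weight31 (-q) q
  have hE := congrArg (rescale q) (evenCarlitz_functional_eq q (by ring : (-1 : R) ^ 2 = 1))
  have hE' := evenCarlitz_eq (-1) q
  simp only [map_neg, map_one, map_add, map_sub, map_mul, rescale_X, rescale_C, one_mul, neg_mul]
    at hA hB hE hG hE'
  set A := treeSeries (weight31 (-q) q)
  set B := treeSeries (weight31' (-q) q)
  set G := treeSeries (restrict TreeCoder (weight31 (-q) q))
  set E := evenCarlitz (-1) q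
  have h : 1 - C q * (B - 1) = 1 - C q * X * rescale q E := by
    refine eq_of_functional_eq (q := q) (e := -C q) ?_ ?_
    · simp only [map_sub, map_one, map_mul, rescale_C]
      linear_combination (- C q * X * (1 - C q * (B - 1))) * hA -
        C q * (1 - C q * X * (1 - C q * (rescale q B - 1))) * hB
    · simp only [map_sub, map_one, map_mul, rescale_C, rescale_X]
      linear_combination hE
  linear_combination E * hG - G * hE' + X * G * E * h

theorem treeSeries_coder_weight13_neg_one (q : R) :
    treeSeries (restrict TreeCoder (weight13 (-1) q)) = 1 - X ^ 2 * evenCarlitz (-1) q ^ 2 := by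
  have hG := treeSeries_coder_weight13 (-1) q
  have hH := treeSeries_coder_weight13' (-1) q
  have hE := evenCarlitz_eq (-1) q
  rw [treeSeries_weight13_neg_one] at hG hH
  simp only [map_neg, map_one, map_add, map_sub, map_mul, rescale_X, one_mul, neg_mul]
    at hG hH hE
  set G := treeSeries (restrict TreeCoder (weight13 (-1) q))
  set H := treeSeries (restrict TreeCoder (weight13' (-1) q))
  set E := evenCarlitz (-1) q
  -- `H` and `E` are both inverses of `1 + q z² E(q z)`.
  have h : H = E := by linear_combination E * hH - H * hE
  rw [h] at hG
  linear_combination hG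

theorem treeSeries_alt (q : R) :
    treeSeries (restrict (TreeAlt false) (weight13 1 q)) = 1 + X ^ 2 * evenCarlitz 1 q ^ 2 := by
  have hU := treeSeries_alt_true q
  have hV := treeSeries_alt_false q
  have hW := treeSeries_alt_false' q
  have hE := evenCarlitz_eq 1 q
  rw [hU] at hV hW
  simp only [map_mul, rescale_X, one_mul] at hW hE
  set W := treeSeries (restrict (TreeAlt false) (weight13' 1 q))
  have h : W = evenCarlitz 1 q := by
    refine eq_of_sub_eq_X_mul (q := q) (u := C q * X * rescale q W)
      (v := C q * X * evenCarlitz 1 q) ?_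
    rw [map_sub]
    linear_combination hW - hE
  rw [h] at hV
  linear_combination hV

theorem coeff_treeSeries_coder_weight13 (q : R) (n : ℕ) :
    coeff n (treeSeries (restrict TreeCoder (weight13 (-1) q))) =
      if Even n then (-1) ^ (n / 2) * cStar (n / 2) q else 0 := by
  -- The parameter `s` enters only through `z² ↦ s z²`, so `s = -1` and `s = 1` differ by `(-1) ^ m`
  -- at `z ^ (2 m)`.
  have key : ∀ s : R, 1 + C s * X ^ 2 * evenCarlitz s q ^ 2 = expand 2 two_ne_zero
      (rescale s (1 + X * rescale q (carlitzSeries (q ^ 2)) ^ 2)) := by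
    intro s
    simp only [map_add, map_one, map_mul, map_pow, rescale_X, expand_X, expand_C,
      rescale_rescale, evenCarlitz, mul_comm s q]
  have h₁ := key (-1)
  have h₂ := key 1
  simp only [map_neg, map_one, neg_mul, one_mul, ← sub_eq_add_neg] at h₁ h₂
  rw [treeSeries_coder_weight13_neg_one, h₁, coeff_expand]
  simp only [even_iff_two_dvd]
  split_ifs with h
  · rw [coeff_rescale, cStar_eq, treeSeries_alt, h₂, coeff_expand, if_pos (dvd_mul_right _ _),
      Nat.mul_div_cancel_left _ two_pos, rescale_one, RingHom.id_apply]
  · rfl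

theorem coeff_one_add_X_mul_evenCarlitz (q : R) {n : ℕ} (hn : 1 ≤ n) :
    coeff n (1 + X * evenCarlitz (-1) q) = if Even n then 0
      else (-q) ^ ((n - 1) / 2) * carlitzCatalan ((n - 1) / 2) (q ^ 2) := by
  obtain ⟨n, rfl⟩ := Nat.exists_eq_add_of_le' hn
  rw [map_add, coeff_one, if_neg n.succ_ne_zero, zero_add, coeff_succ_X_mul, coeff_evenCarlitz,
    neg_one_mul, Nat.add_sub_cancel]
  simp only [Nat.even_add_one, ite_not]

end PermStat

theorem mainTheorem5 {R : Type*} [CommRing R] (q : R) (n : ℕ) (hn : 1 ≤ n) :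
    (∑ π ∈ PermStat.permAvoiding n ![2, 3, 1], (-1) ^ PermStat.des π * q ^ PermStat.vinc31_2 π =
        ∑ π ∈ PermStat.permAvoiding n ![2, 3, 1], (-1) ^ PermStat.des π * q ^ PermStat.vinc13_2 π ∧
      ∑ π ∈ PermStat.permAvoiding n ![2, 3, 1], (-1) ^ PermStat.des π * q ^ PermStat.vinc13_2 π =
        if Even n then 0
        else (-q) ^ ((n - 1) / 2) * ContFrac.carlitzCatalan ((n - 1) / 2) (q ^ 2)) ∧
    (∑ π ∈ PermStat.coderAvoiding n ![2, 3, 1],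
          (-q) ^ PermStat.des π * q ^ PermStat.vinc31_2 π =
        if Even n then (-q) ^ (n / 2) * ContFrac.carlitzCatalan (n / 2) (q ^ 2) else 0) ∧
    (∑ π ∈ PermStat.coderAvoiding n ![2, 3, 1],
          (-1) ^ PermStat.des π * q ^ PermStat.vinc13_2 π =
        if Even n then (-1) ^ (n / 2) * PermStat.cStar (n / 2) q else 0) := by
  refine ⟨⟨?_, ?_⟩, ?_, ?_⟩
  · rw [PermStat.sum_permAvoiding_weight31, PermStat.sum_permAvoiding_weight13,
      PermStat.treeSeries_weight31_neg_one, PermStat.treeSeries_weight13_neg_one]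
  · rw [PermStat.sum_permAvoiding_weight13, PermStat.treeSeries_weight13_neg_one,
      PermStat.coeff_one_add_X_mul_evenCarlitz q hn]
  · rw [PermStat.sum_coderAvoiding_weight31, PermStat.treeSeries_coder_weight31_neg,
      ContFrac.coeff_evenCarlitz, neg_one_mul]
  · rw [PermStat.sum_coderAvoiding_weight13, PermStat.coeff_treeSeries_coder_weight13]
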